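/- **Theorem.** A *graph* in a complex Banach space $X$ is a linear subspace $A\subseteq X\times X$; put $\lambda I+A=\{(u,\lambda u+f):(u,f)\in A\}$ and call a graph *boundedly invertible* if its inverse $\{(f,u):(u,f)\in B\}$ is the graph of an everywhere defined bounded operator $B^{-1}$. A *degenerate semigroup* is a family $S=(S_t)_{t\in(0,\infty)}$ in $\mathcal L(X)$ that is strongly continuous on $(0,\infty)$ and satisfies $S_{t+s}=S_tS_s$ for all $t,s>0$ and $\sup_{0<t<1}\|S_t\|<\infty$. One says that $-A$ *generates* $S$ if there is an $\omega\in\mathbb R$ such that, for all real $\lambda>\omega$, $\lambda I+A$ is boundedly invertible and $(\lambda I+A)^{-1}x=\int_0^\infty e^{-\lambda t}S_tx\,dt$ (a convergent Bochner integral) for all $x\in X$. Let $H$ be a complex Hilbert space, with inner product $(\cdot,\cdot)_H$ linear in the first variable. Let $A_n$ ($n\in\mathbb N$) and $A$ be positive self-adjoint graphs in $H$; that is, each of these graphs $B$ equals its adjoint $\{(v,g):(f,v)_H=(u,g)_H\text{ for all }(u,f)\in B\}$, and $(f,u)_H\ge 0$ for all $(u,f)\in B$. Let $S^{(n)}$ and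 $S$ be the degenerate semigroups generated by $-A_n$ and $-A$. Then the following are equivalent. (A statement that resolvents converge includes that the inverses involved exist as bounded operators; WOT and SOT are the weak and strong operator topologies.) 1. $\lim_{n\to\infty}S^{(n)}_t=S_t$ in $(\mathcal L(H),\mathrm{WOT})$ for all $t\in(0,\infty)$. 2. $\lim_{n\to\infty}\int_0^T(S^{(n)}_tf,g)_H\,dt=\int_0^T(S_tf,g)_H\,dt$ for all $T>0$ and $f,g\in H$. 3. $\lim_{n\to\infty}\int_0^T(S^{(n)}_tf,g(t))_H\,dt=\int_0^T(S_tf,g(t))_H\,dt$ for all $T>0$, $f\in H$ and $g\in L_1([0,T],H)$. 4. $\lim_{n\to\infty}\int_0^T\|(S^{(n)}_t-S_t)f\|_H\,dt=0$ for all $T>0$ and $f\in H$. 5. $\lim_{n\to\infty}(\lambda I+A_n)^{-1}=(\lambda I+A)^{-1}$ in $(\mathcal L(H),\mathrm{SOT})$ for all $\lambda\in\mathbb C$ with $\operatorname{Re}\lambda>0$. 6. There exists a $\lambda\in\mathbb C$ with $\operatorname{Re}\lambda>0$ such that $\lim_{n\to\infty}(\lambda I+A_n)^{-1}=(\lambda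 I+A)^{-1}$ in $(\mathcal L(H),\mathrm{SOT})$. 7. $\lim_{n\to\infty}(\lambda I+A_n)^{-1}=(\lambda I+A)^{-1}$ in $(\mathcal L(H),\mathrm{WOT})$ for all $\lambda\in\mathbb C$ with $\operatorname{Re}\lambda>0$. 8. There exists a set $D\subseteq\mathbb C$ with an accumulation point in the open right half-plane $\{\mu\in\mathbb C:\operatorname{Re}\mu>0\}$ such that $\lim_{n\to\infty}(\lambda I+A_n)^{-1}=(\lambda I+A)^{-1}$ in $(\mathcal L(H),\mathrm{WOT})$ for all $\lambda\in D$. 9. There exists a $\lambda\in\mathbb C\setminus\mathbb R$ with $\operatorname{Re}\lambda>0$ such that $\lim_{n\to\infty}(\lambda I+A_n)^{-1}=(\lambda I+A)^{-1}$ in $(\mathcal L(H),\mathrm{WOT})$. 10. $\lim_{n\to\infty}\sup_{t\in[\delta,T]}\|(S^{(n)}_t-S_t)f\|_H=0$ for all $f\in H$ and $\delta,T>0$ with $\delta<T$. -/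

import Mathlib

open Filter Topology MeasureTheory Set

noncomputable section

/-- A graph in `X` (a linear relation, or multivalued linear operator): a linear subspace of
`X × X`. A pair `(u, f)` in the graph is read as `f ∈ A u`. -/
abbrev OpGraph (X : Type*) [NormedAddCommGroup X] [NormedSpace ℂ X] := Submodule ℂ (X × X)

namespace OpGraph

section Banach

variable {X : Type*} [NormedAddCommGroup X] [NormedSpace ℂ X]

/-- The graph `l I + A = {(u, l u + f) : (u, f) ∈ A}`. -/
def scalarAdd (l : ℂ) (A : OpGraph X) : OpGraph X :=
  A.map ((LinearMap.fst ℂ X X).prod (l • LinearMap.fst ℂ X X + LinearMap.snd ℂ X X))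

lemma mem_scalarAdd {l : ℂ} {A : OpGraph X} {u f : X} :
    (u, f) ∈ scalarAdd l A ↔ (u, f - l • u) ∈ A := by
  rw [scalarAdd, Submodule.mem_map]
  constructor
  · rintro ⟨⟨a, b⟩, h, hab⟩
    obtain ⟨rfl, rfl⟩ := Prod.mk.inj hab
    simpa using h
  · intro h
    exact ⟨(u, f - l • u), h, Prod.ext rfl (by simp)⟩

/-- The inverse graph `{(f, u) : (u, f) ∈ B}`. -/
def inverse (B : OpGraph X) : OpGraph X :=
  B.map (LinearEquiv.prodComm ℂ X X).toLinearMap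

lemma mem_inverse {B : OpGraph X} {u f : X} : (f, u) ∈ inverse B ↔ (u, f) ∈ B := by
  simp [inverse]

/-- A graph is boundedly invertible if its inverse graph is the graph of an everywhere defined
bounded linear operator. -/
def BoundedlyInvertible (B : OpGraph X) : Prop :=
  ∃ R : X →L[ℂ] X, inverse B = (R : X →ₗ[ℂ] X).graph

open Classical in
/-- The bounded operator `B⁻¹` of a boundedly invertible graph `B` (and `0` if `B` is not
boundedly invertible). -/
def boundedInverse (B : OpGraph X) : X →L[ℂ] X :=
  if h : BoundedlyInvertible B then h.choose else 0

lemma inverse_eq_graph {B : OpGraph X} (h : BoundedlyInvertible B) :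
    inverse B = (boundedInverse B : X →ₗ[ℂ] X).graph := by
  rw [boundedInverse, dif_pos h]
  exact h.choose_spec

lemma mem_iff_boundedInverse {B : OpGraph X} (h : BoundedlyInvertible B) {u f : X} :
    (u, f) ∈ B ↔ u = boundedInverse B f := by
  rw [← mem_inverse, inverse_eq_graph h, LinearMap.mem_graph_iff]
  rfl

/-- `(l I + A)⁻¹`, meaningful when `l I + A` is boundedly invertible. -/
def resolvent (A : OpGraph X) (l : ℂ) : X →L[ℂ] X := boundedInverse (scalarAdd l A)

end Banach

section Hilbert

variable {H : Type*} [NormedAddCommGroup H] [InnerProductSpace ℂ H]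

/-- A graph is self-adjoint if it equals its adjoint graph
`{(v, g) : ⟪f, v⟫ = ⟪u, g⟫ for all (u, f) ∈ A}`. -/
def SelfAdjoint (A : OpGraph H) : Prop := Submodule.adjoint A = A

/-- A graph is positive if the inner product of `f` and `u` is real and nonnegative for all
`(u, f) ∈ A`. -/
def Positive (A : OpGraph H) : Prop :=
  ∀ u f : H, (u, f) ∈ A → 0 ≤ (inner ℂ u f).re ∧ (inner ℂ u f).im = 0

end Hilbert

end OpGraph

section Semigroup

variable {X : Type*} [NormedAddCommGroup X] [NormedSpace ℂ X]

/-- A degenerate semigroup: a family `S t`, `t ∈ (0,∞)`, of bounded operators that is strongly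
continuous on `(0,∞)`, satisfies the semigroup law, and is bounded on `(0,1)`. The values `S t` for
`t ≤ 0` are irrelevant. -/
structure IsDegenerateSemigroup (S : ℝ → X →L[ℂ] X) : Prop where
  continuousOn : ∀ x : X, ContinuousOn (fun t => S t x) (Ioi 0)
  add : ∀ t s : ℝ, 0 < t → 0 < s → S (t + s) = S t ∘L S s
  bddAbove : BddAbove ((fun t => ‖S t‖) '' Ioo 0 1)

/-- `-A` is the generator of the degenerate semigroup `S`: for all sufficiently large real `l`, the
graph `l I + A` is boundedly invertible and its inverse is the (convergent) Laplace transform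
of `S` at `l`. -/
def NegGenerates (A : OpGraph X) (S : ℝ → X →L[ℂ] X) : Prop :=
  IsDegenerateSemigroup S ∧
  ∃ ω : ℝ, ∀ l : ℝ, ω < l →
    OpGraph.BoundedlyInvertible (OpGraph.scalarAdd (l : ℂ) A) ∧
    ∀ x : X,
      IntegrableOn (fun t : ℝ => Real.exp (-(l * t)) • S t x) (Ioi 0) ∧
      OpGraph.resolvent A (l : ℂ) x = ∫ t in Ioi (0 : ℝ), Real.exp (-(l * t)) • S t x

/-- Convergence of a sequence of bounded operators in the strong operator topology. -/
def TendstoSOT (T : ℕ → X →L[ℂ] X) (T₀ : X →L[ℂ] X) : Prop :=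
  Tendsto (fun n => (ContinuousLinearMap.toPointwiseConvergenceCLM ℂ (RingHom.id ℂ) X X (T n)))
    atTop (𝓝 (ContinuousLinearMap.toPointwiseConvergenceCLM ℂ (RingHom.id ℂ) X X T₀))

/-- Convergence of a sequence of bounded operators in the weak operator topology. -/
def TendstoWOT (T : ℕ → X →L[ℂ] X) (T₀ : X →L[ℂ] X) : Prop :=
  Tendsto (fun n => ContinuousLinearMapWOT.ofCLM (T n)) atTop
    (𝓝 (ContinuousLinearMapWOT.ofCLM T₀))

/-- All the graphs `l I + A n` and `l I + A₀` are boundedly invertible. -/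
def ResolventsExist (A : ℕ → OpGraph X) (A₀ : OpGraph X) (l : ℂ) : Prop :=
  (∀ n, OpGraph.BoundedlyInvertible (OpGraph.scalarAdd l (A n))) ∧
    OpGraph.BoundedlyInvertible (OpGraph.scalarAdd l A₀)

/-- `(l I + A n)⁻¹ → (l I + A₀)⁻¹` in the strong operator topology (in particular, these inverses
exist as bounded operators). -/
def ResolventTendstoSOT (A : ℕ → OpGraph X) (A₀ : OpGraph X) (l : ℂ) : Prop :=
  ResolventsExist A A₀ l ∧
    TendstoSOT (fun n => OpGraph.resolvent (A n) l) (OpGraph.resolvent A₀ l)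

/-- `(l I + A n)⁻¹ → (l I + A₀)⁻¹` in the weak operator topology (in particular, these inverses
exist as bounded operators). -/
def ResolventTendstoWOT (A : ℕ → OpGraph X) (A₀ : OpGraph X) (l : ℂ) : Prop :=
  ResolventsExist A A₀ l ∧
    TendstoWOT (fun n => OpGraph.resolvent (A n) l) (OpGraph.resolvent A₀ l)

end Semigroup

end

/-!
For a positive self-adjoint graph `A`, the resolvent `R = (I + A)⁻¹` is a bounded self-adjoint
operator with spectrum in `[0, 1]`. By uniqueness of Laplace transforms, the semigroup generated by
`-A` is `S t = φ_t(R)` with `φ_t(x) = exp (-t (1 / x - 1))`. Hence each `S t` is a self-adjoint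
contraction, and `S` is Lipschitz on `[δ, ∞)` with constant `1 / δ` whatever `A` is; these uniform
bounds give the passages between pointwise, integrated and locally uniform convergence. Strong
convergence of the resolvents passes to the semigroups through the functional calculus.

Weak convergence improves to strong convergence because weak convergence of `T n` and of
`(T n)* T n` implies strong convergence of `T n`. For semigroups `(S t)* S t = S (2 t)`. For
resolvents `R(l)* R(l) = R(l̄) R(l)`, which for nonreal `l` is a multiple of `R(l̄) - R(l)` by the
resolvent identity, and for real `l` is a limit of difference quotients `(R(m) - R(l)) / (l - m)`.
-/

namespace OpGraph

section Resolvent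

variable {X : Type*} [NormedAddCommGroup X] [NormedSpace ℂ X] {A B : OpGraph X} {l m : ℂ}

lemma resolvent_mem (h : BoundedlyInvertible (scalarAdd l A)) (f : X) :
    (resolvent A l f, f) ∈ scalarAdd l A :=
  (mem_iff_boundedInverse h).2 rfl

lemma eq_resolvent_of_mem (h : BoundedlyInvertible (scalarAdd l A)) {u f : X}
    (hu : (u, f) ∈ scalarAdd l A) : u = resolvent A l f :=
  (mem_iff_boundedInverse h).1 hu

lemma resolvent_sub_resolvent (hl : BoundedlyInvertible (scalarAdd l A))
    (hm : BoundedlyInvertible (scalarAdd m A)) :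
    resolvent A l - resolvent A m = (m - l) • (resolvent A l * resolvent A m) := by
  ext f
  have h : resolvent A m f = resolvent A l (f + (l - m) • resolvent A m f) := by
    refine eq_resolvent_of_mem hl (mem_scalarAdd.2 ?_)
    convert mem_scalarAdd.1 (resolvent_mem hm f) using 2
    module
  rw [map_add, map_smul] at h
  change resolvent A l f - resolvent A m f = (m - l) • resolvent A l (resolvent A m f)
  rw [sub_eq_iff_eq_add]
  nth_rewrite 2 [h]
  module

lemma one_add_smul_resolvent_mul_resolvent (hl : BoundedlyInvertible (scalarAdd l A))
    (hm : BoundedlyInvertible (scalarAdd m A)) :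
    (1 + (l - m) • resolvent A m) * resolvent A l = resolvent A m := by
  rw [add_mul, one_mul, smul_mul_assoc, ← resolvent_sub_resolvent hm hl, add_sub_cancel]

lemma resolvent_mul_one_add_smul_resolvent (hl : BoundedlyInvertible (scalarAdd l A))
    (hm : BoundedlyInvertible (scalarAdd m A)) :
    resolvent A l * (1 + (l - m) • resolvent A m) = resolvent A m := by
  rw [mul_add, mul_one, mul_smul_comm, ← neg_sub m l, neg_smul, ← resolvent_sub_resolvent hl hm]
  abel

lemma resolvent_sub_resolvent_eq_mul (hAl : BoundedlyInvertible (scalarAdd l A))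
    (hAm : BoundedlyInvertible (scalarAdd m A)) (hBl : BoundedlyInvertible (scalarAdd l B))
    (hBm : BoundedlyInvertible (scalarAdd m B)) :
    resolvent A m - resolvent B m = (1 + (l - m) • resolvent A m) *
      (resolvent A l - resolvent B l) * (1 + (l - m) • resolvent B m) := by
  rw [mul_sub, one_add_smul_resolvent_mul_resolvent hAl hAm, sub_mul, mul_assoc,
    resolvent_mul_one_add_smul_resolvent hBl hBm]
  noncomm_ring

lemma isClosed_scalarAdd (hA : IsClosed (A : Set (X × X))) (l : ℂ) :
    IsClosed (scalarAdd l A : Set (X × X)) := by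
  have h : (scalarAdd l A : Set (X × X)) = (fun p : X × X => (p.1, p.2 - l • p.1)) ⁻¹' A :=
    Set.ext fun _ => mem_scalarAdd
  rw [h]
  exact hA.preimage (by fun_prop)

lemma boundedlyInvertible_of_norm_le [CompleteSpace X] (hB : IsClosed (B : Set (X × X))) {C : ℝ}
    (hC : ∀ u f : X, (u, f) ∈ B → ‖u‖ ≤ C * ‖f‖)
    (hd : (B.map (LinearMap.snd ℂ X X)).topologicalClosure = ⊤) : BoundedlyInvertible B := by
  have : CompleteSpace B := hB.completeSpace_coe
  let p : B →L[ℂ] X := ContinuousLinearMap.snd ℂ X X ∘L B.subtypeL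
  have hp : AntilipschitzWith (max C 1).toNNReal p := by
    refine p.antilipschitz_of_bound fun x => ?_
    rw [Real.coe_toNNReal _ (zero_le_one.trans (le_max_right C 1))]
    refine max_le ((hC _ _ x.2).trans ?_) (le_mul_of_one_le_left (norm_nonneg _) (le_max_right C 1))
    exact mul_le_mul_of_nonneg_right (le_max_left C 1) (norm_nonneg _)
  have hrange : p.range = B.map (LinearMap.snd ℂ X X) := by
    ext f
    simp [p]
  have hbij : Function.Bijective p :=
    p.bijective_iff_dense_range_and_antilipschitz.2 ⟨by rw [hrange, hd], _, hp⟩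
  let e : B ≃L[ℂ] X :=
    .ofBijective p (LinearMap.ker_eq_bot.2 hbij.1) (LinearMap.range_eq_top.2 hbij.2)
  refine ⟨ContinuousLinearMap.fst ℂ X X ∘L B.subtypeL ∘L (e.symm : X →L[ℂ] B), ?_⟩
  ext ⟨f, u⟩
  rw [mem_inverse, LinearMap.mem_graph_iff]
  constructor
  · intro h
    have he : e ⟨(u, f), h⟩ = f := rfl
    change u = (e.symm f : X × X).1
    rw [← he, e.symm_apply_apply]
  · intro h
    have hf : (e.symm f : X × X) = (u, f) := Prod.ext h.symm (e.apply_symm_apply f)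
    exact hf ▸ (e.symm f).2

end Resolvent

section PositiveSelfAdjoint

variable {H : Type*} [NormedAddCommGroup H] [InnerProductSpace ℂ H] {A : OpGraph H} {l m : ℂ}

lemma isClosed_adjoint (A : OpGraph H) : IsClosed (Submodule.adjoint A : Set (H × H)) := by
  have h : (Submodule.adjoint A : Set (H × H)) =
      ⋂ q ∈ A, {p : H × H | inner ℂ q.2 p.1 - inner ℂ q.1 p.2 = 0} := by
    ext p
    simp
  rw [h]
  exact isClosed_biInter fun q _ => isClosed_eq (by fun_prop) continuous_const

lemma Positive.re_mul_norm_sq_le (hA : Positive A) {u f : H} (hu : (u, f) ∈ scalarAdd l A) :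
    l.re * ‖u‖ ^ 2 ≤ (inner ℂ u f).re := by
  have h : 0 ≤ (inner ℂ u (f - l • u)).re := (hA _ _ (mem_scalarAdd.1 hu)).1
  have hself : (inner ℂ u (l • u)).re = l.re * ‖u‖ ^ 2 := by
    rw [inner_smul_right, inner_self_eq_norm_sq_to_K]
    exact (congrArg (fun z => (l * z).re) (Complex.ofReal_pow _ _).symm).trans
      (Complex.re_mul_ofReal _ _)
  rw [inner_sub_right, Complex.sub_re, hself] at h
  exact sub_nonneg.1 h

lemma Positive.norm_le (hA : Positive A) (hl : 0 < l.re) {u f : H}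
    (hu : (u, f) ∈ scalarAdd l A) : ‖u‖ ≤ l.re⁻¹ * ‖f‖ := by
  have h : l.re * ‖u‖ ^ 2 ≤ ‖u‖ * ‖f‖ :=
    (hA.re_mul_norm_sq_le hu).trans (re_inner_le_norm (𝕜 := ℂ) u f)
  rw [inv_mul_eq_div, le_div_iff₀ hl]
  rcases (norm_nonneg u).eq_or_lt with hu0 | hu0
  · rw [← hu0, zero_mul]
    exact norm_nonneg f
  · exact le_of_mul_le_mul_left (by linarith) hu0

lemma Positive.norm_resolvent_le (hA : Positive A) (hl : 0 < l.re)
    (h : BoundedlyInvertible (scalarAdd l A)) : ‖resolvent A l‖ ≤ l.re⁻¹ :=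
  ContinuousLinearMap.opNorm_le_bound _ (by positivity) fun f => hA.norm_le hl (resolvent_mem h f)

/-- Positive self-adjoint graphs, the class to which the convergence theorem applies. -/
def PositiveSelfAdjoint (A : OpGraph H) : Prop := SelfAdjoint A ∧ Positive A

variable [CompleteSpace H]

namespace PositiveSelfAdjoint

lemma topologicalClosure_range_scalarAdd (hA : PositiveSelfAdjoint A) (hl : 0 < l.re) :
    ((scalarAdd l A).map (LinearMap.snd ℂ H H)).topologicalClosure = ⊤ := by
  rw [Submodule.topologicalClosure_eq_top_iff, Submodule.eq_bot_iff]
  intro g hg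
  have horth : ∀ u f, (u, f) ∈ A → inner ℂ (l • u + f) g = 0 := fun u f huf =>
    hg _ ⟨(u, l • u + f), mem_scalarAdd.2 (by simpa using huf), rfl⟩
  have hmem : (g, -(starRingEnd ℂ l • g)) ∈ A := by
    rw [← hA.1, Submodule.mem_adjoint_iff]
    intro u f huf
    have h := horth u f huf
    rw [inner_add_left, inner_smul_left] at h
    simp only [inner_neg_right, inner_smul_right]
    linear_combination h
  have hg0 : (g, (0 : H)) ∈ scalarAdd (starRingEnd ℂ l) A :=
    mem_scalarAdd.2 (by rwa [zero_sub])
  simpa using hA.2.norm_le (by simpa using hl) hg0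

lemma boundedlyInvertible (hA : PositiveSelfAdjoint A) (hl : 0 < l.re) :
    BoundedlyInvertible (scalarAdd l A) := by
  have hclosed : IsClosed (A : Set (H × H)) := hA.1 ▸ isClosed_adjoint A
  exact boundedlyInvertible_of_norm_le (isClosed_scalarAdd hclosed l)
    (fun _ _ => hA.2.norm_le hl) (hA.topologicalClosure_range_scalarAdd hl)

lemma norm_resolvent_le (hA : PositiveSelfAdjoint A) (hl : 0 < l.re) :
    ‖resolvent A l‖ ≤ l.re⁻¹ :=
  hA.2.norm_resolvent_le hl (hA.boundedlyInvertible hl)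

lemma resolvent_sub_resolvent (hA : PositiveSelfAdjoint A) (hl : 0 < l.re) (hm : 0 < m.re) :
    resolvent A l - resolvent A m = (m - l) • (resolvent A l * resolvent A m) :=
  OpGraph.resolvent_sub_resolvent (hA.boundedlyInvertible hl) (hA.boundedlyInvertible hm)

lemma norm_resolvent_sub_resolvent_le (hA : PositiveSelfAdjoint A) (hl : 0 < l.re)
    (hm : 0 < m.re) : ‖resolvent A l - resolvent A m‖ ≤ ‖m - l‖ * (l.re⁻¹ * m.re⁻¹) := by
  rw [hA.resolvent_sub_resolvent hl hm, norm_smul]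
  gcongr
  exact (norm_mul_le _ _).trans <| mul_le_mul (hA.norm_resolvent_le hl) (hA.norm_resolvent_le hm)
    (norm_nonneg _) (by positivity)

lemma resolvent_mul_resolvent (hA : PositiveSelfAdjoint A) (hl : 0 < l.re) (hm : 0 < m.re)
    (hlm : l ≠ m) :
    resolvent A l * resolvent A m = (m - l)⁻¹ • (resolvent A l - resolvent A m) := by
  rw [hA.resolvent_sub_resolvent hl hm, inv_smul_smul₀ (sub_ne_zero.2 hlm.symm)]

lemma star_resolvent (hA : PositiveSelfAdjoint A) (hl : 0 < l.re) :
    star (resolvent A l) = resolvent A (starRingEnd ℂ l) := by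
  symm
  rw [ContinuousLinearMap.star_eq_adjoint, ContinuousLinearMap.eq_adjoint_iff]
  intro f g
  have hf := mem_scalarAdd.1 <| resolvent_mem (l := starRingEnd ℂ l)
    (hA.boundedlyInvertible (by simpa using hl)) f
  have hg : (resolvent A l g, g - l • resolvent A l g) ∈ Submodule.adjoint A :=
    hA.1.symm ▸ mem_scalarAdd.1 (resolvent_mem (hA.boundedlyInvertible hl) g)
  have h := (Submodule.mem_adjoint_iff _ _).1 hg _ _ hf
  simp only [inner_sub_left, inner_sub_right, inner_smul_left, inner_smul_right,
    Complex.conj_conj] at h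
  linear_combination -h

lemma isSelfAdjoint_resolvent_ofReal (hA : PositiveSelfAdjoint A) {l : ℝ} (hl : 0 < l) :
    IsSelfAdjoint (resolvent A (l : ℂ)) := by
  rw [isSelfAdjoint_iff, hA.star_resolvent (by simpa using hl), Complex.conj_ofReal]

lemma isSelfAdjoint_resolvent_one (hA : PositiveSelfAdjoint A) :
    IsSelfAdjoint (resolvent A 1) := by
  simpa using hA.isSelfAdjoint_resolvent_ofReal one_pos

lemma resolvent_one_nonneg (hA : PositiveSelfAdjoint A) : 0 ≤ resolvent A 1 := by
  rw [ContinuousLinearMap.nonneg_iff_isPositive, ContinuousLinearMap.isPositive_def']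
  refine ⟨hA.isSelfAdjoint_resolvent_one, fun f => le_trans (by simp)
    (hA.2.re_mul_norm_sq_le (resolvent_mem (hA.boundedlyInvertible (by simp)) f))⟩

lemma spectrum_resolvent_one_subset (hA : PositiveSelfAdjoint A) :
    spectrum ℝ (resolvent A 1) ⊆ Icc 0 1 := by
  intro x hx
  have hnorm : ‖resolvent A 1‖ ≤ 1 := by simpa using hA.norm_resolvent_le (l := 1) (by simp)
  refine ⟨spectrum_nonneg_of_nonneg hA.resolvent_one_nonneg hx, (le_abs_self x).trans ?_⟩
  exact (spectrum.norm_le_norm_mul_of_mem hx).trans <|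
    mul_le_one₀ hnorm (norm_nonneg _) ContinuousLinearMap.norm_id_le

end PositiveSelfAdjoint

end PositiveSelfAdjoint

end OpGraph

section LaplaceTransform

variable {E : Type*} [NormedAddCommGroup E] [NormedSpace ℝ E]

lemma integral_comp_smul_eq_zero_of_integral_pow_smul_eq_zero {α : Type*} [MeasurableSpace α]
    {μ : Measure α} {u : α → ℝ} {k : α → E} {a b : ℝ} (hu : AEStronglyMeasurable u μ)
    (hab : ∀ᵐ x ∂μ, u x ∈ Icc a b) (hk : Integrable k μ) (h : ∀ n : ℕ, ∫ x, u x ^ n • k x ∂μ = 0)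
    {g : ℝ → ℝ} (hg : Continuous g) : ∫ x, g (u x) • k x ∂μ = 0 := by
  have hint : ∀ {q : ℝ → ℝ}, Continuous q → Integrable (fun x => q (u x) • k x) μ := by
    intro q hq
    obtain ⟨C, hC⟩ := isCompact_Icc.exists_bound_of_continuousOn (s := Icc a b) hq.continuousOn
    exact hk.bdd_smul C (hq.comp_aestronglyMeasurable hu) (hab.mono fun x hx => hC _ hx)
  have hpoly : ∀ p : Polynomial ℝ, ∫ x, p.eval (u x) • k x ∂μ = 0 := by
    intro p
    simp_rw [Polynomial.eval_eq_sum_range, Finset.sum_smul, mul_smul]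
    have hterm : ∀ i ∈ Finset.range (p.natDegree + 1),
        Integrable (fun x => p.coeff i • u x ^ i • k x) μ :=
      fun i _ => (hint (continuous_pow i)).smul (p.coeff i)
    rw [integral_finsetSum _ hterm]
    exact Finset.sum_eq_zero fun i _ => by rw [integral_smul, h i, smul_zero]
  have hle : ∀ ε > 0, ‖∫ x, g (u x) • k x ∂μ‖ ≤ ε * ∫ x, ‖k x‖ ∂μ := by
    intro ε hε
    obtain ⟨p, hp⟩ := exists_polynomial_near_of_continuousOn a b g hg.continuousOn ε hε
    rw [← sub_zero (∫ x, _ ∂μ), ← hpoly p, ← integral_sub (hint hg) (hint p.continuous),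
      ← integral_const_mul]
    refine norm_integral_le_of_norm_le (hk.norm.const_mul ε) (hab.mono fun x hx => ?_)
    rw [← sub_smul, norm_smul, norm_sub_rev]
    gcongr
    exact (hp _ hx).le
  have hlim : Tendsto (fun ε => ε * ∫ x, ‖k x‖ ∂μ) (𝓝[>] 0) (𝓝 0) := by
    have : Tendsto (fun ε : ℝ => ε * ∫ x, ‖k x‖ ∂μ) (𝓝 0) (𝓝 (0 * ∫ x, ‖k x‖ ∂μ)) :=
      tendsto_id.mul_const _
    rw [zero_mul] at this
    exact this.mono_left nhdsWithin_le_nhds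
  exact norm_le_zero_iff.1 <| ge_of_tendsto hlim (eventually_mem_nhdsWithin.mono hle)

lemma continuous_comp_neg_log {φ : ℝ → ℝ} (hφ : Continuous φ) (hc : HasCompactSupport φ)
    (h0 : φ 0 = 0) : Continuous fun x => φ (-Real.log x) := by
  refine continuous_iff_continuousAt.2 fun x => ?_
  rcases eq_or_ne x 0 with rfl | hx
  · have hlog : Tendsto (fun x => -Real.log x) (𝓝[≠] 0) (cocompact ℝ) :=
      (tendsto_neg_atBot_atTop.comp Real.tendsto_log_nhdsNE_zero).mono_right atTop_le_cocompact
    -- Here `Real.log 0 = 0` makes the value at `0` agree with the limit.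
    rw [continuousAt_iff_punctured_nhds, Real.log_zero, neg_zero, h0]
    exact hc.is_zero_at_infty.comp hlog
  · exact hφ.continuousAt.comp (Real.continuousAt_log hx).neg

variable [CompleteSpace E]

lemma eqOn_zero_of_integral_exp_neg_pow_smul_eq_zero {k : ℝ → E} (hc : ContinuousOn k (Ioi 0))
    (hk : IntegrableOn k (Ioi 0))
    (h : ∀ n : ℕ, ∫ t in Ioi (0 : ℝ), Real.exp (-t) ^ n • k t = 0) : EqOn k 0 (Ioi 0) := by
  have hexp : ∀ᵐ t ∂volume.restrict (Ioi (0 : ℝ)), Real.exp (-t) ∈ Icc (0 : ℝ) 1 :=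
    ae_restrict_of_forall_mem measurableSet_Ioi fun t ht =>
      ⟨(Real.exp_pos _).le, Real.exp_le_one_iff.2 (neg_nonpos.2 (le_of_lt ht))⟩
  have htest : ∀ φ : ℝ → ℝ, Continuous φ → HasCompactSupport φ → tsupport φ ⊆ Ioi 0 →
      ∫ t, φ t • k t = 0 := by
    intro φ hφ hφc hφs
    have h0 : ∀ t ∉ Ioi (0 : ℝ), φ t = 0 := fun t ht =>
      image_eq_zero_of_notMem_tsupport fun h => ht (hφs h)
    have hφlog := integral_comp_smul_eq_zero_of_integral_pow_smul_eq_zero (by fun_prop) hexp hk h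
      (continuous_comp_neg_log hφ hφc (h0 0 self_notMem_Ioi))
    simp only [Real.log_exp, neg_neg] at hφlog
    rwa [← setIntegral_eq_integral_of_forall_compl_eq_zero fun t ht => by rw [h0 t ht, zero_smul]]
  have hae : ∀ᵐ t : ℝ, t ∈ Ioi (0 : ℝ) → k t = 0 :=
    isOpen_Ioi.ae_eq_zero_of_integral_contDiff_smul_eq_zero
      (hc.locallyIntegrableOn measurableSet_Ioi) fun φ hφ => htest φ hφ.continuous
  exact Measure.eqOn_open_of_ae_eq ((ae_restrict_iff' measurableSet_Ioi).2 hae) isOpen_Ioi hc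
    continuousOn_const

lemma eqOn_of_laplace_eq {h₁ h₂ : ℝ → E} (hc₁ : ContinuousOn h₁ (Ioi 0))
    (hc₂ : ContinuousOn h₂ (Ioi 0)) {ω : ℝ}
    (hi₁ : ∀ l, ω < l → IntegrableOn (fun t => Real.exp (-(l * t)) • h₁ t) (Ioi 0))
    (hi₂ : ∀ l, ω < l → IntegrableOn (fun t => Real.exp (-(l * t)) • h₂ t) (Ioi 0))
    (h : ∀ l, ω < l → ∫ t in Ioi (0 : ℝ), Real.exp (-(l * t)) • h₁ t =
      ∫ t in Ioi (0 : ℝ), Real.exp (-(l * t)) • h₂ t) : EqOn h₁ h₂ (Ioi 0) := by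
  set c := ω + 1
  have hn : ∀ n : ℕ, ω < c + n := fun n => by
    have := n.cast_nonneg (α := ℝ)
    simp only [c]
    linarith
  have hpow : ∀ (n : ℕ) (t : ℝ), Real.exp (-t) ^ n • Real.exp (-(c * t)) • (h₁ t - h₂ t) =
      Real.exp (-((c + n) * t)) • h₁ t - Real.exp (-((c + n) * t)) • h₂ t := by
    intro n t
    rw [← Real.exp_nat_mul, smul_smul, ← Real.exp_add, ← smul_sub]
    ring_nf
  have hint : IntegrableOn (fun t => Real.exp (-(c * t)) • (h₁ t - h₂ t)) (Ioi 0) := by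
    simp_rw [smul_sub]
    exact (hi₁ c (lt_add_one ω)).sub (hi₂ c (lt_add_one ω))
  have hcont : ContinuousOn (fun t => Real.exp (-(c * t)) • (h₁ t - h₂ t)) (Ioi 0) :=
    ContinuousOn.smul (by fun_prop) (hc₁.sub hc₂)
  have hzero := eqOn_zero_of_integral_exp_neg_pow_smul_eq_zero hcont hint fun n => by
      rw [funext (hpow n), integral_sub (hi₁ _ (hn n)) (hi₂ _ (hn n)), h _ (hn n), sub_self]
  exact fun t ht => sub_eq_zero.1 ((smul_eq_zero.1 (hzero ht)).resolve_left (Real.exp_pos _).ne')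

end LaplaceTransform

section HeatSymbol

variable {δ l s t x y : ℝ}

/-- The function `x ↦ exp (-t (1 / x - 1))`, which sends the resolvent at `1` of a positive
self-adjoint graph `A` to the semigroup `exp (-t A)`. The value `0` at `x = 0` makes it continuous
on `[0, ∞)` for `t > 0`, and corresponds to the multivalued part of the graph. -/
noncomputable def heatSymbol (t x : ℝ) : ℝ := if x = 0 then 0 else Real.exp (-(t * (x⁻¹ - 1)))

lemma heatSymbol_zero_right (t : ℝ) : heatSymbol t 0 = 0 := if_pos rfl

lemma heatSymbol_of_ne_zero (t : ℝ) (hx : x ≠ 0) :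
    heatSymbol t x = Real.exp (-(t * (x⁻¹ - 1))) := if_neg hx

lemma heatSymbol_nonneg (t x : ℝ) : 0 ≤ heatSymbol t x := by
  unfold heatSymbol
  split_ifs <;> positivity

lemma inv_sub_one_nonneg (hx : x ∈ Icc 0 1) (h0 : x ≠ 0) : 0 ≤ x⁻¹ - 1 :=
  sub_nonneg.2 ((one_le_inv₀ (hx.1.lt_of_ne' h0)).2 hx.2)

lemma heatSymbol_le_one (ht : 0 ≤ t) (hx : x ∈ Icc 0 1) : heatSymbol t x ≤ 1 := by
  rcases eq_or_ne x 0 with rfl | h0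
  · simp [heatSymbol_zero_right]
  · rw [heatSymbol_of_ne_zero t h0, Real.exp_le_one_iff, neg_nonpos]
    exact mul_nonneg ht (inv_sub_one_nonneg hx h0)

lemma norm_heatSymbol_le_one (ht : 0 ≤ t) (hx : x ∈ Icc 0 1) : ‖heatSymbol t x‖ ≤ 1 := by
  rw [Real.norm_of_nonneg (heatSymbol_nonneg t x)]
  exact heatSymbol_le_one ht hx

lemma heatSymbol_le_exp_mul_div (ht : 0 < t) (hx : 0 ≤ x) :
    heatSymbol t x ≤ Real.exp t * (x / t) := by
  rcases hx.eq_or_lt with rfl | hx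
  · simp [heatSymbol_zero_right]
  · have hsplit : -(t * (x⁻¹ - 1)) = t + -(t / x) := by ring
    rw [heatSymbol_of_ne_zero t hx.ne', hsplit, Real.exp_add, Real.exp_neg, ← inv_div t x]
    gcongr
    linarith [Real.add_one_le_exp (t / x)]

lemma continuousOn_uncurry_heatSymbol :
    ContinuousOn (Function.uncurry heatSymbol) (Ioi 0 ×ˢ Ici 0) := by
  rintro ⟨t, x⟩ ⟨ht : 0 < t, hx⟩
  rcases eq_or_ne x 0 with rfl | h0
  · have hbound : ContinuousAt (fun p : ℝ × ℝ => Real.exp p.1 * (p.2 / p.1)) (t, 0) := by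
      fun_prop (disch := exact ht.ne')
    have hlim := hbound.continuousWithinAt (s := Ioi 0 ×ˢ Ici 0)
    rw [ContinuousWithinAt, zero_div, mul_zero] at hlim
    rw [ContinuousWithinAt, Function.uncurry_apply_pair, heatSymbol_zero_right]
    exact tendsto_of_tendsto_of_tendsto_of_le_of_le' tendsto_const_nhds hlim
      (.of_forall fun p => heatSymbol_nonneg _ _)
      (eventually_mem_nhdsWithin.mono fun p hp => heatSymbol_le_exp_mul_div hp.1 hp.2)
  · have hformula : ContinuousAt (fun p : ℝ × ℝ => Real.exp (-(p.1 * (p.2⁻¹ - 1)))) (t, x) := by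
      fun_prop (disch := exact h0)
    refine (hformula.congr ?_).continuousWithinAt
    filter_upwards [continuousAt_snd.eventually_ne h0] with p hp
    exact (heatSymbol_of_ne_zero p.1 hp).symm

lemma abs_exp_neg_mul_sub_exp_neg_mul_le (hδ : 0 < δ) (hs : δ ≤ s) (ht : δ ≤ t) (hy : 0 ≤ y) :
    |Real.exp (-(t * y)) - Real.exp (-(s * y))| ≤ δ⁻¹ * |t - s| := by
  have hderiv : ∀ r ∈ Ici δ, HasDerivWithinAt (fun r => Real.exp (-(r * y)))
      (Real.exp (-(r * y)) * -(1 * y)) (Ici δ) r := fun r _ =>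
    (((hasDerivAt_id r).mul_const y).neg.exp).hasDerivWithinAt
  refine (convex_Ici δ).norm_image_sub_le_of_norm_hasDerivWithin_le hderiv (fun r hr => ?_) hs ht
  have hexp : δ * y ≤ Real.exp (r * y) := by
    nlinarith [Real.add_one_le_exp (r * y), mul_le_mul_of_nonneg_right (mem_Ici.1 hr) hy]
  rw [one_mul, mul_neg, norm_neg, norm_mul, Real.norm_of_nonneg (Real.exp_pos _).le,
    Real.norm_of_nonneg hy, Real.exp_neg, inv_mul_le_iff₀ (Real.exp_pos _), ← div_eq_mul_inv,
    le_div_iff₀ hδ, mul_comm]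
  exact hexp

lemma abs_heatSymbol_sub_le (hδ : 0 < δ) (hs : δ ≤ s) (ht : δ ≤ t) (hx : x ∈ Icc 0 1) :
    |heatSymbol t x - heatSymbol s x| ≤ δ⁻¹ * |t - s| := by
  rcases eq_or_ne x 0 with rfl | h0
  · rw [heatSymbol_zero_right, heatSymbol_zero_right, sub_zero, abs_zero]
    positivity
  · rw [heatSymbol_of_ne_zero t h0, heatSymbol_of_ne_zero s h0]
    exact abs_exp_neg_mul_sub_exp_neg_mul_le hδ hs ht (inv_sub_one_nonneg hx h0)

lemma integral_exp_neg_mul_heatSymbol (hl : 0 < l) (hx : x ∈ Icc 0 1) :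
    ∫ t in Ioi (0 : ℝ), Real.exp (-(l * t)) * heatSymbol t x = x / (1 + (l - 1) * x) := by
  rcases eq_or_ne x 0 with rfl | h0
  · simp [heatSymbol_zero_right]
  · have hrate : 0 < l + (x⁻¹ - 1) := add_pos_of_pos_of_nonneg hl (inv_sub_one_nonneg hx h0)
    have hexp : ∀ t : ℝ, Real.exp (-(l * t)) * heatSymbol t x =
        Real.exp (-(l + (x⁻¹ - 1)) * t) := fun t => by
      rw [heatSymbol_of_ne_zero t h0, ← Real.exp_add]
      ring_nf
    have hden : 1 + (l - 1) * x = x * (l + (x⁻¹ - 1)) := by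
      field_simp
      ring
    simp_rw [hexp]
    rw [integral_exp_mul_Ioi (neg_neg_of_pos hrate), mul_zero, Real.exp_zero, neg_div_neg_eq,
      hden, div_mul_cancel_left₀ h0, one_div]

end HeatSymbol

section Representation

open scoped NNReal

lemma continuousOn_Ioi_of_lipschitzOnWith_Ici {α : Type*} [PseudoMetricSpace α] {F : ℝ → α}
    {K : ℝ → ℝ≥0} (hF : ∀ δ > 0, LipschitzOnWith (K δ) F (Ici δ)) : ContinuousOn F (Ioi 0) :=
  fun t ht => ((hF (t / 2) (half_pos ht)).continuousOn.continuousAt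
    (Ici_mem_nhds (half_lt_self ht))).continuousWithinAt

variable {H : Type*} [NormedAddCommGroup H] [InnerProductSpace ℂ H] [CompleteSpace H]
  {A : OpGraph H} {l s t δ : ℝ}

namespace OpGraph

/-- The degenerate semigroup `exp (-t A)`, `t > 0`, of a positive self-adjoint graph `A`, obtained
from the continuous functional calculus of the bounded self-adjoint operator `(I + A)⁻¹`. -/
noncomputable def expNeg (A : OpGraph H) (t : ℝ) : H →L[ℂ] H :=
  cfc (heatSymbol t) (resolvent A 1)

lemma isSelfAdjoint_expNeg (A : OpGraph H) (t : ℝ) : IsSelfAdjoint (expNeg A t) :=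
  cfc_predicate _ _

namespace PositiveSelfAdjoint

lemma one_add_mul_pos_of_mem_spectrum (hA : PositiveSelfAdjoint A) (hl : 0 < l) {x : ℝ}
    (hx : x ∈ spectrum ℝ (resolvent A 1)) : 0 < 1 + (l - 1) * x := by
  obtain ⟨hx0, hx1⟩ := hA.spectrum_resolvent_one_subset hx
  rcases hx0.eq_or_lt with rfl | hx0
  · simp
  · nlinarith [mul_pos hl hx0]

lemma resolvent_ofReal_eq_cfc (hA : PositiveSelfAdjoint A) (hl : 0 < l) :
    resolvent A (l : ℂ) = cfc (fun x : ℝ => x / (1 + (l - 1) * x)) (resolvent A 1) := by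
  have hsa := hA.isSelfAdjoint_resolvent_one
  have hinv := hA.boundedlyInvertible (l := l) (by simpa using hl)
  have hinv₁ := hA.boundedlyInvertible (l := 1) (by simp)
  have hne : ∀ x ∈ spectrum ℝ (resolvent A 1), 1 + (l - 1) * x ≠ 0 := fun x hx =>
    (hA.one_add_mul_pos_of_mem_spectrum hl hx).ne'
  have hdenom : cfc (fun x : ℝ => 1 + (l - 1) * x) (resolvent A 1) =
      1 + ((l : ℂ) - 1) • resolvent A 1 := by
    rw [cfc_add .., cfc_const_mul .., cfc_id' .., cfc_const_one .., ← Complex.ofReal_one,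
      ← Complex.ofReal_sub, Complex.coe_smul]
  have hunit : IsUnit (cfc (fun x : ℝ => 1 + (l - 1) * x) (resolvent A 1)) :=
    (isUnit_cfc_iff _ _).2 hne
  refine hunit.mul_right_cancel ?_
  rw [← cfc_mul (fun x : ℝ => x / (1 + (l - 1) * x)) _ _
    (ContinuousOn.div₀ (by fun_prop) (by fun_prop) hne) (by fun_prop), hdenom,
    resolvent_mul_one_add_smul_resolvent hinv hinv₁]
  rw [cfc_congr fun x hx => div_mul_cancel₀ x (hne x hx), cfc_id' ..]

lemma continuousOn_heatSymbol (hA : PositiveSelfAdjoint A) (ht : 0 < t) :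
    ContinuousOn (heatSymbol t) (spectrum ℝ (resolvent A 1)) :=
  continuousOn_uncurry_heatSymbol.comp (f := fun x => (t, x)) (by fun_prop)
    fun _ hx => ⟨ht, (hA.spectrum_resolvent_one_subset hx).1⟩

lemma norm_expNeg_le_one (hA : PositiveSelfAdjoint A) (ht : 0 ≤ t) : ‖expNeg A t‖ ≤ 1 :=
  norm_cfc_le zero_le_one fun _ hx =>
    norm_heatSymbol_le_one ht (hA.spectrum_resolvent_one_subset hx)

lemma lipschitzOnWith_expNeg (hA : PositiveSelfAdjoint A) (hδ : 0 < δ) :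
    LipschitzOnWith δ⁻¹.toNNReal (expNeg A) (Ici δ) := by
  refine LipschitzOnWith.of_dist_le_mul fun t ht s hs => ?_
  rw [dist_eq_norm, Real.dist_eq, Real.coe_toNNReal _ (inv_nonneg.2 hδ.le), expNeg, expNeg,
    ← cfc_sub _ _ _ (hA.continuousOn_heatSymbol (hδ.trans_le ht))
      (hA.continuousOn_heatSymbol (hδ.trans_le hs))]
  exact norm_cfc_le (by positivity) fun x hx =>
    abs_heatSymbol_sub_le hδ hs ht (hA.spectrum_resolvent_one_subset hx)

lemma norm_exp_mul_heatSymbol_le {x : ℝ} (hA : PositiveSelfAdjoint A) (ht : 0 ≤ t)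
    (hx : x ∈ spectrum ℝ (resolvent A 1)) :
    ‖Real.exp (-(l * t)) * heatSymbol t x‖ ≤ Real.exp (-l * t) := by
  rw [norm_mul, Real.norm_of_nonneg (Real.exp_pos _).le, neg_mul]
  exact mul_le_of_le_one_right (Real.exp_pos _).le
    (norm_heatSymbol_le_one ht (hA.spectrum_resolvent_one_subset hx))

lemma hasLaplace_expNeg (hA : PositiveSelfAdjoint A) (hl : 0 < l) :
    IntegrableOn (fun t : ℝ => Real.exp (-(l * t)) • expNeg A t) (Ioi 0) ∧
    ∫ t in Ioi (0 : ℝ), Real.exp (-(l * t)) • expNeg A t = resolvent A (l : ℂ) := by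
  have hsa := hA.isSelfAdjoint_resolvent_one
  have hσ := hA.spectrum_resolvent_one_subset
  have hcont : ContinuousOn
      (Function.uncurry fun t x : ℝ => Real.exp (-(l * t)) * heatSymbol t x)
      (Ioi 0 ×ˢ spectrum ℝ (resolvent A 1)) :=
    ContinuousOn.mul (f := fun p : ℝ × ℝ => Real.exp (-(l * p.1))) (by fun_prop) <|
      continuousOn_uncurry_heatSymbol.mono <| prod_mono Subset.rfl fun x hx => (hσ hx).1
  have hbound : ∀ᵐ t ∂volume.restrict (Ioi (0 : ℝ)), ∀ x ∈ spectrum ℝ (resolvent A 1),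
      ‖Real.exp (-(l * t)) * heatSymbol t x‖ ≤ Real.exp (-l * t) :=
    ae_restrict_of_forall_mem measurableSet_Ioi fun t ht x =>
      hA.norm_exp_mul_heatSymbol_le (le_of_lt ht)
  have hfin : HasFiniteIntegral (fun t => Real.exp (-l * t)) (volume.restrict (Ioi (0 : ℝ))) :=
    (integrableOn_exp_mul_Ioi (neg_neg_of_pos hl) 0).2
  have hcfc : EqOn (fun t => cfc (fun x => Real.exp (-(l * t)) * heatSymbol t x) (resolvent A 1))
      (fun t => Real.exp (-(l * t)) • expNeg A t) (Ioi 0) := fun t ht =>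
    cfc_const_mul _ _ _ (hA.continuousOn_heatSymbol ht)
  refine ⟨(integrableOn_cfc measurableSet_Ioi _ _ _ hcont hbound hfin hsa).congr_fun hcfc
    measurableSet_Ioi, ?_⟩
  rw [← setIntegral_congr_fun measurableSet_Ioi hcfc,
    ← cfc_setIntegral measurableSet_Ioi _ _ _ hcont hbound hfin hsa, hA.resolvent_ofReal_eq_cfc hl]
  exact cfc_congr fun x hx => integral_exp_neg_mul_heatSymbol hl (hσ hx)

end PositiveSelfAdjoint

end OpGraph

namespace NegGenerates

variable {S : ℝ → H →L[ℂ] H}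

lemma eqOn_expNeg (h : NegGenerates A S) (hA : A.PositiveSelfAdjoint) :
    EqOn S A.expNeg (Ioi 0) := by
  obtain ⟨hS, ω, hω⟩ := h
  intro t ht
  ext f
  have hcont : ContinuousOn (fun t => A.expNeg t f) (Ioi 0) :=
    (continuousOn_Ioi_of_lipschitzOnWith_Ici fun δ hδ =>
      hA.lipschitzOnWith_expNeg hδ).clm_apply continuousOn_const
  have hlaplace : ∀ l, max ω 0 < l →
      IntegrableOn (fun t => Real.exp (-(l * t)) • A.expNeg t f) (Ioi 0) ∧
      ∫ t in Ioi (0 : ℝ), Real.exp (-(l * t)) • A.expNeg t f = A.resolvent l f := by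
    intro l hl
    obtain ⟨hint, heq⟩ := hA.hasLaplace_expNeg ((le_max_right ω 0).trans_lt hl)
    exact ⟨(ContinuousLinearMap.apply ℂ H f).integrable_comp hint,
      heq ▸ (ContinuousLinearMap.integral_apply hint f).symm⟩
  have hω' : ∀ l, max ω 0 < l → ω < l := fun l hl => (le_max_left ω 0).trans_lt hl
  exact eqOn_of_laplace_eq (hS.continuousOn f) hcont
    (fun l hl => ((hω l (hω' l hl)).2 f).1) (fun l hl => (hlaplace l hl).1)
    (fun l hl => ((hω l (hω' l hl)).2 f).2.symm.trans (hlaplace l hl).2.symm) ht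

lemma norm_apply_le (h : NegGenerates A S) (hA : A.PositiveSelfAdjoint) (ht : 0 < t) (f : H) :
    ‖S t f‖ ≤ ‖f‖ := by
  rw [h.eqOn_expNeg hA ht, ← one_mul ‖f‖]
  exact (A.expNeg t).le_of_opNorm_le (hA.norm_expNeg_le_one ht.le) f

lemma lipschitzOnWith_apply (h : NegGenerates A S) (hA : A.PositiveSelfAdjoint) (f : H)
    (hδ : 0 < δ) : LipschitzOnWith (δ⁻¹.toNNReal * ‖f‖₊) (fun t => S t f) (Ici δ) := by
  refine LipschitzOnWith.of_dist_le_mul fun t ht s hs => ?_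
  have hdist := (hA.lipschitzOnWith_expNeg hδ).dist_le_mul t ht s hs
  rw [← h.eqOn_expNeg hA (hδ.trans_le ht), ← h.eqOn_expNeg hA (hδ.trans_le hs)] at hdist
  calc dist (S t f) (S s f) ≤ dist (S t) (S s) * ‖f‖ := by
        rw [dist_eq_norm, dist_eq_norm]
        exact (S t - S s).le_opNorm f
    _ ≤ _ := by
        rw [NNReal.coe_mul, coe_nnnorm, mul_right_comm]
        gcongr

lemma star_mul_self (h : NegGenerates A S) (hA : A.PositiveSelfAdjoint) (ht : 0 < t) :
    star (S t) * S t = S (t + t) := by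
  have hself : star (S t) = S t := by
    rw [h.eqOn_expNeg hA ht]
    exact A.isSelfAdjoint_expNeg t
  rw [hself, h.1.add t t ht ht]
  rfl

lemma integral_exp_neg_smul_apply (h : NegGenerates A S) (hA : A.PositiveSelfAdjoint) (f : H) :
    ∫ t in Ioi (0 : ℝ), Real.exp (-t) • S t f = A.resolvent 1 f := by
  obtain ⟨hint, heq⟩ := hA.hasLaplace_expNeg one_pos
  have hS : EqOn (fun t => Real.exp (-t) • S t f)
      (fun t => (Real.exp (-(1 * t)) • A.expNeg t) f) (Ioi 0) := fun t ht => by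
    simp only [h.eqOn_expNeg hA ht, one_mul, smul_apply]
  rw [setIntegral_congr_fun measurableSet_Ioi hS, ← ContinuousLinearMap.integral_apply hint, heq,
    Complex.ofReal_one]

end NegGenerates

end Representation

section OperatorConvergence

lemma tendsto_of_dist_le_of_tendsto {ι κ α : Type*} [PseudoMetricSpace α] {p : Filter ι} [p.NeBot]
    {q : Filter κ} {F : ι → κ → α} {f : κ → α} {L : ι → α} {ℓ : α} {b : ι → ℝ}
    (hb : Tendsto b p (𝓝 0)) (hF : ∀ᶠ i in p, ∀ n, dist (F i n) (f n) ≤ b i)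
    (hL : ∀ᶠ i in p, dist (L i) ℓ ≤ b i) (h : ∀ᶠ i in p, Tendsto (F i) q (𝓝 (L i))) :
    Tendsto f q (𝓝 ℓ) := by
  have hunif : TendstoUniformly F f p := Metric.tendstoUniformly_iff.2 fun ε hε => by
    filter_upwards [hF, hb.eventually_lt_const hε] with i hi hbi n
    rw [dist_comm]
    exact (hi n).trans_lt hbi
  have hlim : Tendsto L p (𝓝 ℓ) :=
    tendsto_iff_dist_tendsto_zero.2 <|
      squeeze_zero' (Eventually.of_forall fun _ => dist_nonneg) hL hb
  exact hunif.tendsto_of_eventually_tendsto h hlim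

section Banach

variable {X : Type*} [NormedAddCommGroup X] [NormedSpace ℂ X]
  {T U : ℕ → X →L[ℂ] X} {T₀ U₀ : X →L[ℂ] X}

lemma tendstoSOT_iff : TendstoSOT T T₀ ↔ ∀ x, Tendsto (fun n => T n x) atTop (𝓝 (T₀ x)) :=
  PointwiseConvergenceCLM.tendsto_iff_forall_tendsto

namespace TendstoSOT

lemma tendsto_apply (hT : TendstoSOT T T₀) {C : ℝ} (hC : ∀ n, ‖T n‖ ≤ C) {x : ℕ → X} {x₀ : X}
    (hx : Tendsto x atTop (𝓝 x₀)) : Tendsto (fun n => T n (x n)) atTop (𝓝 (T₀ x₀)) := by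
  have hdiff : Tendsto (fun n => T n (x n - x₀)) atTop (𝓝 0) := by
    refine squeeze_zero_norm (fun n => (T n).le_of_opNorm_le (hC n) _) ?_
    simpa only [mul_zero] using (tendsto_iff_norm_sub_tendsto_zero.1 hx).const_mul C
  simpa only [map_sub, sub_add_cancel, zero_add] using hdiff.add (tendstoSOT_iff.1 hT x₀)

protected lemma mul (hT : TendstoSOT T T₀) {C : ℝ} (hC : ∀ n, ‖T n‖ ≤ C) (hU : TendstoSOT U U₀) :
    TendstoSOT (fun n => T n * U n) (T₀ * U₀) :=
  tendstoSOT_iff.2 fun x => hT.tendsto_apply hC (tendstoSOT_iff.1 hU x)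

protected lemma pow (hT : TendstoSOT T T₀) {C : ℝ} (hC : ∀ n, ‖T n‖ ≤ C) (k : ℕ) :
    TendstoSOT (fun n => T n ^ k) (T₀ ^ k) := by
  induction k with
  | zero => simpa only [pow_zero] using tendstoSOT_iff.2 fun _ => tendsto_const_nhds
  | succ k ih => simpa only [pow_succ'] using hT.mul hC ih

protected lemma aeval (hT : TendstoSOT T T₀) {C : ℝ} (hC : ∀ n, ‖T n‖ ≤ C) (p : Polynomial ℝ) :
    TendstoSOT (fun n => Polynomial.aeval (T n) p) (Polynomial.aeval T₀ p) := by
  refine tendstoSOT_iff.2 fun x => ?_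
  simp only [Polynomial.aeval_eq_sum_range, sum_apply, smul_apply]
  exact tendsto_finsetSum _ fun i _ => (tendstoSOT_iff.1 (hT.pow hC i) x).const_smul _

end TendstoSOT

namespace TendstoWOT

protected lemma sub (hT : TendstoWOT T T₀) (hU : TendstoWOT U U₀) :
    TendstoWOT (fun n => T n - U n) (T₀ - U₀) :=
  Tendsto.sub hT hU

protected lemma const_smul (hT : TendstoWOT T T₀) (c : ℂ) :
    TendstoWOT (fun n => c • T n) (c • T₀) :=
  Tendsto.const_smul hT c

end TendstoWOT

end Banach

variable {H : Type*} [NormedAddCommGroup H] [InnerProductSpace ℂ H] [CompleteSpace H]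
  {T : ℕ → H →L[ℂ] H} {T₀ : H →L[ℂ] H}

protected lemma TendstoSOT.cfc {a b : ℝ} {F : ℝ → ℝ} (hF : ContinuousOn F (Icc a b))
    (hT : TendstoSOT T T₀) (hsa : ∀ n, IsSelfAdjoint (T n)) (hsa₀ : IsSelfAdjoint T₀)
    (hσ : ∀ n, spectrum ℝ (T n) ⊆ Icc a b) (hσ₀ : spectrum ℝ T₀ ⊆ Icc a b) :
    TendstoSOT (fun n => cfc F (T n)) (cfc F T₀) := by
  have hbound : ∀ n, ‖T n‖ ≤ max |a| |b| := fun n => by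
    rw [← cfc_id' ℝ (T n) (hsa n)]
    exact norm_cfc_le (by positivity) fun x hx => abs_le_max_abs_abs (hσ n hx).1 (hσ n hx).2
  choose! p hp using fun ε => exists_polynomial_near_of_continuousOn a b F hF ε
  have happrox : ∀ V : H →L[ℂ] H, IsSelfAdjoint V → spectrum ℝ V ⊆ Icc a b → ∀ f, ∀ ε > 0,
      dist (Polynomial.aeval V (p ε) f) (cfc F V f) ≤ ε * ‖f‖ := by
    intro V hV hVσ f ε hε
    rw [← cfc_polynomial (p ε) V hV, dist_eq_norm, ← sub_apply,
      ← cfc_sub _ _ _ (by fun_prop) (hF.mono hVσ)]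
    exact ContinuousLinearMap.le_of_opNorm_le _
      (norm_cfc_le hε.le fun x hx => (hp ε hε x (hVσ hx)).le) f
  refine tendstoSOT_iff.2 fun f => tendsto_of_dist_le_of_tendsto (p := 𝓝[>] 0)
    (b := fun ε => ε * ‖f‖) ?_ ?_ ?_ (Eventually.of_forall fun ε =>
      tendstoSOT_iff.1 (hT.aeval hbound (p ε)) f)
  · exact ((continuous_mul_const ‖f‖).tendsto' 0 0 (zero_mul _)).mono_left nhdsWithin_le_nhds
  · filter_upwards [self_mem_nhdsWithin] with ε hε n using happrox _ (hsa n) (hσ n) f ε hε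
  · filter_upwards [self_mem_nhdsWithin] with ε hε using happrox _ hsa₀ hσ₀ f ε hε

lemma tendstoWOT_iff_inner : TendstoWOT T T₀ ↔
    ∀ f g : H, Tendsto (fun n => inner ℂ g (T n f)) atTop (𝓝 (inner ℂ g (T₀ f))) :=
  ContinuousLinearMapWOT.tendsto_iff_forall_inner_apply_tendsto

lemma TendstoSOT.tendstoWOT (h : TendstoSOT T T₀) : TendstoWOT T T₀ :=
  tendstoWOT_iff_inner.2 fun f _ => tendsto_const_nhds.inner (tendstoSOT_iff.1 h f)

namespace TendstoWOT

protected lemma star (hT : TendstoWOT T T₀) : TendstoWOT (fun n => star (T n)) (star T₀) := by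
  refine tendstoWOT_iff_inner.2 fun f g => ?_
  simp only [ContinuousLinearMap.star_eq_adjoint, ContinuousLinearMap.adjoint_inner_right]
  simpa only [Function.comp_def, inner_conj_symm] using
    (Complex.continuous_conj.tendsto _).comp (tendstoWOT_iff_inner.1 hT g f)

lemma of_norm_sub_le {ι : Type*} {p : Filter ι} [p.NeBot] {F : ι → ℕ → H →L[ℂ] H}
    {L : ι → H →L[ℂ] H} {b : ι → ℝ} (hb : Tendsto b p (𝓝 0))
    (hF : ∀ᶠ i in p, ∀ n, ‖F i n - T n‖ ≤ b i) (hL : ∀ᶠ i in p, ‖L i - T₀‖ ≤ b i)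
    (h : ∀ᶠ i in p, TendstoWOT (F i) (L i)) : TendstoWOT T T₀ := by
  refine tendstoWOT_iff_inner.2 fun f g => ?_
  have hinner : ∀ (V W : H →L[ℂ] H) {c : ℝ}, ‖V - W‖ ≤ c →
      dist (inner ℂ g (V f)) (inner ℂ g (W f)) ≤ ‖g‖ * (c * ‖f‖) := by
    intro V W c hVW
    rw [dist_eq_norm, ← inner_sub_right]
    exact (norm_inner_le_norm _ _).trans (by gcongr; exact (V - W).le_of_opNorm_le hVW f)
  refine tendsto_of_dist_le_of_tendsto (b := fun i => ‖g‖ * (b i * ‖f‖)) ?_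
    (hF.mono fun i hi n => hinner _ _ (hi n)) (hL.mono fun i hi => hinner _ _ hi)
    (h.mono fun i hi => tendstoWOT_iff_inner.1 hi f g)
  simpa only [zero_mul, mul_zero] using (hb.mul_const ‖f‖).const_mul ‖g‖

-- `‖T n f - T₀ f‖² = ⟪f, T n* T n f⟫ - ⟪T n f, T₀ f⟫ - ⟪T₀ f, T n f⟫ + ‖T₀ f‖²`.
lemma tendstoSOT_of_star_mul (hT : TendstoWOT T T₀)
    (hTT : TendstoWOT (fun n => star (T n) * T n) (star T₀ * T₀)) :
    TendstoSOT T T₀ := by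
  refine tendstoSOT_iff.2 fun f => ?_
  have hself : Tendsto (fun n => inner ℂ (T n f) (T n f)) atTop (𝓝 (inner ℂ (T₀ f) (T₀ f))) := by
    simpa only [ContinuousLinearMap.star_eq_adjoint, mul_apply_eq_comp,
      ContinuousLinearMap.adjoint_inner_right] using tendstoWOT_iff_inner.1 hTT f f
  have hright := tendstoWOT_iff_inner.1 hT f (T₀ f)
  have hleft : Tendsto (fun n => inner ℂ (T n f) (T₀ f)) atTop (𝓝 (inner ℂ (T₀ f) (T₀ f))) := by
    simpa only [Function.comp_def, inner_conj_symm] using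
      (Complex.continuous_conj.tendsto _).comp hright
  have hsq : Tendsto (fun n => ‖T n f - T₀ f‖ ^ 2) atTop (𝓝 0) := by
    have hexpand := (hself.sub hleft).sub (hright.sub_const (inner ℂ (T₀ f) (T₀ f)))
    simp only [← inner_sub_right, ← inner_sub_left, sub_self] at hexpand
    simpa [inner_self_eq_norm_sq_to_K] using hexpand.norm
  rw [tendsto_iff_norm_sub_tendsto_zero]
  simpa using hsq.sqrt

end TendstoWOT

end OperatorConvergence

section ResolventConvergence

lemma ResolventTendstoSOT.of_norm_le {X : Type*} [NormedAddCommGroup X] [NormedSpace ℂ X]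
    {A : ℕ → OpGraph X} {A₀ : OpGraph X} {l m : ℂ} (h : ResolventTendstoSOT A A₀ l)
    (hm : ResolventsExist A A₀ m) {C : ℝ} (hC : ∀ n, ‖(A n).resolvent m‖ ≤ C) :
    ResolventTendstoSOT A A₀ m := by
  refine ⟨hm, tendstoSOT_iff.2 fun x => ?_⟩
  set y := (1 + (l - m) • A₀.resolvent m) x
  set V : ℕ → X →L[ℂ] X := fun n => 1 + (l - m) • (A n).resolvent m
  have hV : ∀ n, ‖V n‖ ≤ 1 + ‖l - m‖ * C := fun n => by
    refine (norm_add_le _ _).trans (add_le_add ContinuousLinearMap.norm_id_le ?_)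
    rw [norm_smul]
    gcongr
    exact hC n
  have hy : Tendsto (fun n => ‖(A n).resolvent l y - A₀.resolvent l y‖) atTop (𝓝 0) :=
    tendsto_iff_norm_sub_tendsto_zero.1 (tendstoSOT_iff.1 h.2 y)
  have heq : ∀ n, (A n).resolvent m x - A₀.resolvent m x =
      V n ((A n).resolvent l y - A₀.resolvent l y) := fun n =>
    DFunLike.congr_fun
      (OpGraph.resolvent_sub_resolvent_eq_mul (h.1.1 n) (hm.1 n) h.1.2 hm.2) x
  refine tendsto_sub_nhds_zero_iff.1 (squeeze_zero_norm (fun n => ?_)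
    (by simpa only [mul_zero] using hy.const_mul (1 + ‖l - m‖ * C)))
  rw [heq]
  exact (V n).le_of_opNorm_le (hV n) _

variable {H : Type*} [NormedAddCommGroup H] [InnerProductSpace ℂ H] [CompleteSpace H]
  {A : ℕ → OpGraph H} {A₀ : OpGraph H} {l m : ℂ}

lemma ResolventTendstoSOT.resolventTendstoWOT (h : ResolventTendstoSOT A A₀ l) :
    ResolventTendstoWOT A A₀ l :=
  ⟨h.1, h.2.tendstoWOT⟩

lemma resolventsExist (hA : ∀ n, (A n).PositiveSelfAdjoint) (hA₀ : A₀.PositiveSelfAdjoint)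
    (hl : 0 < l.re) : ResolventsExist A A₀ l :=
  ⟨fun n => (hA n).boundedlyInvertible hl, hA₀.boundedlyInvertible hl⟩

namespace ResolventTendstoSOT

lemma of_re_pos (h : ResolventTendstoSOT A A₀ l) (hA : ∀ n, (A n).PositiveSelfAdjoint)
    (hA₀ : A₀.PositiveSelfAdjoint) (hm : 0 < m.re) : ResolventTendstoSOT A A₀ m :=
  h.of_norm_le (resolventsExist hA hA₀ hm) fun n => (hA n).norm_resolvent_le hm

lemma tendstoSOT_expNeg (h : ResolventTendstoSOT A A₀ 1) (hA : ∀ n, (A n).PositiveSelfAdjoint)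
    (hA₀ : A₀.PositiveSelfAdjoint) {t : ℝ} (ht : 0 < t) :
    TendstoSOT (fun n => (A n).expNeg t) (A₀.expNeg t) := by
  have hcont : ContinuousOn (heatSymbol t) (Icc 0 1) :=
    continuousOn_uncurry_heatSymbol.comp (f := fun x => (t, x)) (by fun_prop)
      fun x hx => ⟨ht, hx.1⟩
  exact h.2.cfc hcont (fun n => (hA n).isSelfAdjoint_resolvent_one)
    hA₀.isSelfAdjoint_resolvent_one (fun n => (hA n).spectrum_resolvent_one_subset)
    hA₀.spectrum_resolvent_one_subset

end ResolventTendstoSOT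

lemma ResolventTendstoWOT.resolventTendstoSOT_of_im_ne_zero (h : ResolventTendstoWOT A A₀ l)
    (hA : ∀ n, (A n).PositiveSelfAdjoint) (hA₀ : A₀.PositiveSelfAdjoint) (hl : 0 < l.re)
    (him : l.im ≠ 0) : ResolventTendstoSOT A A₀ l := by
  have hne : starRingEnd ℂ l ≠ l := fun heq => him (Complex.conj_eq_iff_im.1 heq)
  have hstar_mul : ∀ {B : OpGraph H}, B.PositiveSelfAdjoint →
      star (B.resolvent l) * B.resolvent l =
        (l - starRingEnd ℂ l)⁻¹ • (star (B.resolvent l) - B.resolvent l) := fun hB => by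
    rw [hB.star_resolvent hl, hB.resolvent_mul_resolvent (by rwa [Complex.conj_re]) hl hne]
  refine ⟨h.1, h.2.tendstoSOT_of_star_mul ?_⟩
  simp only [hstar_mul (hA _), hstar_mul hA₀]
  exact (h.2.star.sub h.2).const_smul _

section AccumulationPoint

-- The norms of the resolvents are at most `2 / Re m` near `m`, uniformly in `B`.
lemma OpGraph.eventually_norm_resolvent_sub_resolvent_le (hm : 0 < m.re) :
    ∀ᶠ l in 𝓝 m, ∀ B : OpGraph H, B.PositiveSelfAdjoint →
      ‖B.resolvent l - B.resolvent m‖ ≤ ‖m - l‖ * ((m.re / 2)⁻¹ * m.re⁻¹) := by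
  filter_upwards [Complex.continuous_re.continuousAt.eventually_const_lt (half_lt_self hm)]
    with l hl B hB
  refine (hB.norm_resolvent_sub_resolvent_le ((half_pos hm).trans hl) hm).trans ?_
  gcongr

lemma tendsto_norm_sub_mul_const (m : ℂ) (C : ℝ) :
    Tendsto (fun l => ‖m - l‖ * C) (𝓝 m) (𝓝 0) :=
  (by fun_prop : Continuous fun l => ‖m - l‖ * C).tendsto' m 0
    (by rw [sub_self, norm_zero, zero_mul])

variable {p : Filter ℂ} [p.NeBot]

lemma tendstoWOT_resolvent_of_eventually (hp : p ≤ 𝓝 m)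
    (h : ∀ᶠ l in p, ResolventTendstoWOT A A₀ l) (hA : ∀ n, (A n).PositiveSelfAdjoint)
    (hA₀ : A₀.PositiveSelfAdjoint) (hm : 0 < m.re) :
    TendstoWOT (fun n => (A n).resolvent m) (A₀.resolvent m) := by
  have hle := (OpGraph.eventually_norm_resolvent_sub_resolvent_le (H := H) hm).filter_mono hp
  exact .of_norm_sub_le ((tendsto_norm_sub_mul_const m _).mono_left hp)
    (hle.mono fun l hl n => hl (A n) (hA n)) (hle.mono fun l hl => hl A₀ hA₀)
    (h.mono fun l hl => hl.2)

-- `R(m)²` is the limit of the difference quotients `R(l)R(m) = (R(l) - R(m)) / (m - l)`.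
lemma tendstoWOT_resolvent_mul_resolvent_of_eventually (hp : p ≤ 𝓝[≠] m)
    (h : ∀ᶠ l in p, ResolventTendstoWOT A A₀ l) (hA : ∀ n, (A n).PositiveSelfAdjoint)
    (hA₀ : A₀.PositiveSelfAdjoint) (hm : 0 < m.re) :
    TendstoWOT (fun n => (A n).resolvent m * (A n).resolvent m)
      (A₀.resolvent m * A₀.resolvent m) := by
  have hnhds : p ≤ 𝓝 m := hp.trans nhdsWithin_le_nhds
  have hle : ∀ᶠ l in p, ∀ B : OpGraph H, B.PositiveSelfAdjoint →
      ‖B.resolvent l * B.resolvent m - B.resolvent m * B.resolvent m‖ ≤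
        ‖m - l‖ * ((m.re / 2)⁻¹ * m.re⁻¹ * m.re⁻¹) := by
    filter_upwards [hnhds (OpGraph.eventually_norm_resolvent_sub_resolvent_le (H := H) hm)]
      with l hl B hB
    rw [← sub_mul, ← mul_assoc]
    refine (norm_mul_le _ _).trans ?_
    gcongr
    exacts [hl B hB, hB.norm_resolvent_le hm]
  refine .of_norm_sub_le ((tendsto_norm_sub_mul_const m _).mono_left hnhds)
    (hle.mono fun l hl n => hl (A n) (hA n)) (hle.mono fun l hl => hl A₀ hA₀) ?_
  have hm' := tendstoWOT_resolvent_of_eventually hnhds h hA hA₀ hm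
  filter_upwards [h, hp eventually_mem_nhdsWithin,
    hnhds (Complex.continuous_re.continuousAt.eventually_const_lt hm)] with l hlw hne hl
  simp only [(hA _).resolvent_mul_resolvent hl hm hne, hA₀.resolvent_mul_resolvent hl hm hne]
  exact (hlw.2.sub hm').const_smul _

lemma resolventTendstoSOT_of_eventually (hp : p ≤ 𝓝[≠] m)
    (h : ∀ᶠ l in p, ResolventTendstoWOT A A₀ l) (hA : ∀ n, (A n).PositiveSelfAdjoint)
    (hA₀ : A₀.PositiveSelfAdjoint) (hm : 0 < m.re) : ResolventTendstoSOT A A₀ m := by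
  have hw : ResolventTendstoWOT A A₀ m := ⟨resolventsExist hA hA₀ hm,
    tendstoWOT_resolvent_of_eventually (hp.trans nhdsWithin_le_nhds) h hA hA₀ hm⟩
  by_cases him : m.im = 0
  · have hstar : ∀ {B : OpGraph H}, B.PositiveSelfAdjoint →
        star (B.resolvent m) = B.resolvent m := fun hB => by
      rw [hB.star_resolvent hm, Complex.conj_eq_iff_im.2 him]
    refine ⟨hw.1, hw.2.tendstoSOT_of_star_mul ?_⟩
    simpa only [hstar (hA _), hstar hA₀] using
      tendstoWOT_resolvent_mul_resolvent_of_eventually hp h hA hA₀ hm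
  · exact hw.resolventTendstoSOT_of_im_ne_zero hA hA₀ hm him

lemma resolventTendstoSOT_of_accPt {D : Set ℂ} (hD : AccPt m (𝓟 D))
    (h : ∀ l ∈ D, ResolventTendstoWOT A A₀ l) (hA : ∀ n, (A n).PositiveSelfAdjoint)
    (hA₀ : A₀.PositiveSelfAdjoint) (hm : 0 < m.re) : ResolventTendstoSOT A A₀ m :=
  have : (𝓝[≠] m ⊓ 𝓟 D).NeBot := hD
  resolventTendstoSOT_of_eventually inf_le_left (mem_inf_of_right (mem_principal.2 h)) hA hA₀ hm

end AccumulationPoint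

end ResolventConvergence

section FunctionConvergence

lemma tendstoUniformlyOn_of_lipschitzOnWith {ι α β : Type*} [PseudoEMetricSpace α]
    [PseudoEMetricSpace β] {F : ι → α → β} {f : α → β} {p : Filter ι} {s : Set α} {K : NNReal}
    (hs : IsCompact s) (hF : ∀ i, LipschitzOnWith K (F i) s)
    (h : ∀ x ∈ s, Tendsto (fun i => F i x) p (𝓝 (f x))) : TendstoUniformlyOn F f p s := by
  have hequi : EquicontinuousOn F s :=
    (LipschitzOnWith.uniformEquicontinuousOn F K hF).equicontinuousOn
  refine UniformOnFun.tendsto_iff_tendstoUniformlyOn.1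
    ((EquicontinuousOn.tendsto_uniformOnFun_iff_pi' (𝔖 := {s}) (by simpa) (by simpa) p f).2 ?_)
    s rfl
  exact tendsto_pi_nhds.2 fun x => h x (by simpa using x.2)

lemma tendstoUniformlyOn_iff_tendsto_iSup_enorm {ι α E : Type*} [SeminormedAddCommGroup E]
    {F : ι → α → E} {f : α → E} {p : Filter ι} {s : Set α} :
    TendstoUniformlyOn F f p s ↔ Tendsto (fun i => ⨆ x ∈ s, ‖F i x - f x‖ₑ) p (𝓝 0) := by
  simp only [EMetric.tendstoUniformlyOn_iff, ENNReal.tendsto_nhds_zero, edist_comm (f _),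
    edist_eq_enorm_sub]
  refine ⟨fun h ε hε => (h ε hε).mono fun i hi => iSup₂_le fun x hx => (hi x hx).le,
    fun h ε hε => ?_⟩
  obtain ⟨r, hr, hrε⟩ := exists_between hε
  exact (h r hr).mono fun i hi x hx => ((iSup₂_le_iff.1 hi) x hx).trans_lt hrε

variable {E : Type*} [NormedAddCommGroup E] [NormedSpace ℝ E] [CompleteSpace E]

lemma dist_inv_smul_integral_le_of_lipschitzOnWith {f : ℝ → E} {K : NNReal} {s ε : ℝ}
    (hf : LipschitzOnWith K f (Ici s)) (hε : 0 < ε) :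
    dist (ε⁻¹ • ∫ t in s..s + ε, f t) (f s) ≤ K * ε := by
  have hsub : uIcc s (s + ε) ⊆ Ici s := by
    rw [uIcc_of_le (by linarith)]
    exact Icc_subset_Ici_self
  have hmean : ε⁻¹ • (∫ t in s..s + ε, f t) - f s = ε⁻¹ • ∫ t in s..s + ε, (f t - f s) := by
    rw [intervalIntegral.integral_sub (hf.continuousOn.mono hsub).intervalIntegrable
      intervalIntegrable_const, intervalIntegral.integral_const, add_sub_cancel_left, smul_sub,
      inv_smul_smul₀ hε.ne']
  have hnorm : ∀ t ∈ uIoc s (s + ε), ‖f t - f s‖ ≤ K * ε := fun t ht => by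
    rw [uIoc_of_le (by linarith)] at ht
    refine (hf.norm_sub_le ht.1.le self_mem_Ici).trans ?_
    gcongr
    rw [Real.norm_of_nonneg (by linarith [ht.1])]
    linarith [ht.2]
  rw [dist_eq_norm, hmean, norm_smul, norm_inv, Real.norm_of_nonneg hε.le, inv_mul_le_iff₀ hε]
  simpa only [add_sub_cancel_left, abs_of_pos hε, mul_comm ε] using
    intervalIntegral.norm_integral_le_of_norm_le_const hnorm

lemma tendsto_of_tendsto_integral_of_lipschitzOnWith {ι : Type*} {q : Filter ι} {F : ι → ℝ → E}
    {f : ℝ → E} {K : NNReal} {s : ℝ} (hF : ∀ i, LipschitzOnWith K (F i) (Ici s))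
    (hf : LipschitzOnWith K f (Ici s)) (h : ∀ ε > 0,
      Tendsto (fun i => ∫ t in s..s + ε, F i t) q (𝓝 (∫ t in s..s + ε, f t))) :
    Tendsto (fun i => F i s) q (𝓝 (f s)) := by
  have hb : Tendsto (fun ε : ℝ => K * ε) (𝓝[>] 0) (𝓝 0) :=
    ((continuous_const_mul (K : ℝ)).tendsto' 0 0 (mul_zero _)).mono_left nhdsWithin_le_nhds
  have hpos : ∀ᶠ ε : ℝ in 𝓝[>] 0, 0 < ε := eventually_mem_nhdsWithin
  exact tendsto_of_dist_le_of_tendsto hb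
    (hpos.mono fun ε hε i => dist_inv_smul_integral_le_of_lipschitzOnWith (hF i) hε)
    (hpos.mono fun ε hε => dist_inv_smul_integral_le_of_lipschitzOnWith hf hε)
    (hpos.mono fun ε hε => (h ε hε).const_smul ε⁻¹)

end FunctionConvergence

section SemigroupConvergence

section Banach

variable {X : Type*} [NormedAddCommGroup X] [NormedSpace ℂ X]

lemma IsDegenerateSemigroup.aestronglyMeasurable {S : ℝ → X →L[ℂ] X}
    (h : IsDegenerateSemigroup S) (x : X) :
    AEStronglyMeasurable (fun t => S t x) (volume.restrict (Ioi 0)) :=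
  (h.continuousOn x).aestronglyMeasurable measurableSet_Ioi

lemma tendsto_apply_of_tendsto_iSup_enorm {S : ℕ → ℝ → X →L[ℂ] X} {S₀ : ℝ → X →L[ℂ] X} {x : X}
    {s : Set ℝ} (h : Tendsto (fun n => ⨆ t ∈ s, ‖(S n t - S₀ t) x‖ₑ) atTop (𝓝 0)) {t : ℝ}
    (ht : t ∈ s) : Tendsto (fun n => S n t x) atTop (𝓝 (S₀ t x)) :=
  (tendstoUniformlyOn_iff_tendsto_iSup_enorm (F := fun n t => S n t x).2 h).tendsto_at ht

end Banach

variable {H : Type*} [NormedAddCommGroup H] [InnerProductSpace ℂ H] [CompleteSpace H]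
  {A : ℕ → OpGraph H} {A₀ : OpGraph H} {S : ℕ → ℝ → H →L[ℂ] H} {S₀ : ℝ → H →L[ℂ] H} {T : ℝ}

lemma NegGenerates.intervalIntegrable_apply {B : OpGraph H} {U : ℝ → H →L[ℂ] H}
    (h : NegGenerates B U) (hB : B.PositiveSelfAdjoint) (f : H) (hT : 0 ≤ T) :
    IntervalIntegrable (fun t => U t f) volume 0 T := by
  rw [intervalIntegrable_iff_integrableOn_Ioc_of_le hT]
  refine (integrable_const ‖f‖).mono'
    ((h.1.aestronglyMeasurable f).mono_set Ioc_subset_Ioi_self) ?_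
  exact ae_restrict_of_forall_mem measurableSet_Ioc fun t ht => h.norm_apply_le hB ht.1 f

lemma tendstoSOT_of_forall_tendstoWOT (hS : ∀ n, NegGenerates (A n) (S n))
    (hS₀ : NegGenerates A₀ S₀) (hA : ∀ n, (A n).PositiveSelfAdjoint)
    (hA₀ : A₀.PositiveSelfAdjoint) (h : ∀ t : ℝ, 0 < t → TendstoWOT (fun n => S n t) (S₀ t))
    {t : ℝ} (ht : 0 < t) : TendstoSOT (fun n => S n t) (S₀ t) := by
  refine (h t ht).tendstoSOT_of_star_mul ?_
  simpa only [(hS _).star_mul_self (hA _) ht, hS₀.star_mul_self hA₀ ht] using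
    h (t + t) (by positivity)

lemma tendsto_iSup_enorm_of_tendstoSOT (hS : ∀ n, NegGenerates (A n) (S n))
    (hA : ∀ n, (A n).PositiveSelfAdjoint)
    (h : ∀ t : ℝ, 0 < t → TendstoSOT (fun n => S n t) (S₀ t)) (f : H) {δ : ℝ} (hδ : 0 < δ) :
    Tendsto (fun n => ⨆ t ∈ Icc δ T, ‖(S n t - S₀ t) f‖ₑ) atTop (𝓝 0) :=
  tendstoUniformlyOn_iff_tendsto_iSup_enorm.1 <| tendstoUniformlyOn_of_lipschitzOnWith
    (F := fun n t => S n t f) isCompact_Icc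
    (fun n => ((hS n).lipschitzOnWith_apply (hA n) f hδ).mono Icc_subset_Ici_self)
    fun t ht => tendstoSOT_iff.1 (h t (hδ.trans_le ht.1)) f

lemma tendsto_integral_norm_of_tendstoSOT (hS : ∀ n, NegGenerates (A n) (S n))
    (hS₀ : NegGenerates A₀ S₀) (hA : ∀ n, (A n).PositiveSelfAdjoint)
    (hA₀ : A₀.PositiveSelfAdjoint) (h : ∀ t : ℝ, 0 < t → TendstoSOT (fun n => S n t) (S₀ t))
    (hT : 0 ≤ T) (f : H) :
    Tendsto (fun n => ∫ t in (0 : ℝ)..T, ‖(S n t - S₀ t) f‖) atTop (𝓝 0) := by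
  have hlim := intervalIntegral.tendsto_integral_filter_of_dominated_convergence
    (F := fun n t => ‖(S n t - S₀ t) f‖) (f := fun _ => (0 : ℝ)) (l := atTop) (μ := volume)
    (a := 0) (b := T) (fun _ => ‖f‖ + ‖f‖) (.of_forall fun n => ?_) (.of_forall fun n => ?_)
    intervalIntegrable_const ?_
  · simpa only [intervalIntegral.integral_zero] using hlim
  · rw [uIoc_of_le hT]
    exact ((((hS n).1.aestronglyMeasurable f).sub (hS₀.1.aestronglyMeasurable f)).mono_set
      Ioc_subset_Ioi_self).norm
  · refine .of_forall fun t ht => ?_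
    rw [uIoc_of_le hT] at ht
    rw [norm_norm]
    exact (norm_sub_le _ _).trans
      (add_le_add ((hS n).norm_apply_le (hA n) ht.1 f) (hS₀.norm_apply_le hA₀ ht.1 f))
  · refine .of_forall fun t ht => ?_
    rw [uIoc_of_le hT] at ht
    exact tendsto_iff_norm_sub_tendsto_zero.1 (tendstoSOT_iff.1 (h t ht.1) f)

lemma tendsto_integral_inner_of_tendstoWOT (hS : ∀ n, NegGenerates (A n) (S n))
    (hA : ∀ n, (A n).PositiveSelfAdjoint)
    (h : ∀ t : ℝ, 0 < t → TendstoWOT (fun n => S n t) (S₀ t)) (hT : 0 ≤ T) (f : H) {g : ℝ → H}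
    (hg : IntegrableOn g (Icc 0 T)) :
    Tendsto (fun n => ∫ t in (0 : ℝ)..T, inner ℂ (g t) (S n t f)) atTop
      (𝓝 (∫ t in (0 : ℝ)..T, inner ℂ (g t) (S₀ t f))) := by
  have hg' : IntegrableOn g (Ioc 0 T) := hg.mono_set Ioc_subset_Icc_self
  simp only [intervalIntegral.integral_of_le hT]
  refine tendsto_integral_of_dominated_convergence (fun t => ‖g t‖ * ‖f‖)
    (fun n => hg'.aestronglyMeasurable.inner
      (((hS n).1.aestronglyMeasurable f).mono_set Ioc_subset_Ioi_self))
    (hg'.norm.mul_const _) (fun n => ?_) ?_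
  · refine ae_restrict_of_forall_mem measurableSet_Ioc fun t ht => ?_
    exact (norm_inner_le_norm _ _).trans (by gcongr; exact (hS n).norm_apply_le (hA n) ht.1 f)
  · exact ae_restrict_of_forall_mem measurableSet_Ioc fun t ht =>
      tendstoWOT_iff_inner.1 (h t ht.1) f (g t)

lemma tendsto_integral_inner_of_tendsto_integral_norm (hS : ∀ n, NegGenerates (A n) (S n))
    (hS₀ : NegGenerates A₀ S₀) (hA : ∀ n, (A n).PositiveSelfAdjoint)
    (hA₀ : A₀.PositiveSelfAdjoint) (hT : 0 ≤ T) {f : H}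
    (h : Tendsto (fun n => ∫ t in (0 : ℝ)..T, ‖(S n t - S₀ t) f‖) atTop (𝓝 0)) (g : H) :
    Tendsto (fun n => ∫ t in (0 : ℝ)..T, inner ℂ g (S n t f)) atTop
      (𝓝 (∫ t in (0 : ℝ)..T, inner ℂ g (S₀ t f))) := by
  have hint := fun n => (hS n).intervalIntegrable_apply (hA n) f hT
  have hint₀ := hS₀.intervalIntegrable_apply hA₀ f hT
  have hlim : Tendsto (fun n => ∫ t in (0 : ℝ)..T, S n t f) atTop
      (𝓝 (∫ t in (0 : ℝ)..T, S₀ t f)) := by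
    refine tendsto_iff_norm_sub_tendsto_zero.2
      (squeeze_zero (fun _ => norm_nonneg _) (fun n => ?_) h)
    rw [← intervalIntegral.integral_sub (hint n) hint₀]
    exact intervalIntegral.norm_integral_le_integral_norm hT
  have hinner : ∀ {u : ℝ → H}, IntervalIntegrable u volume 0 T →
      ∫ t in (0 : ℝ)..T, inner ℂ g (u t) = inner ℂ g (∫ t in (0 : ℝ)..T, u t) := fun hu =>
    (innerSL ℂ g).intervalIntegral_comp_comm hu
  simp only [hinner (hint _), hinner hint₀]
  exact tendsto_const_nhds.inner hlim

lemma tendstoWOT_of_tendsto_integral_inner (hS : ∀ n, NegGenerates (A n) (S n))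
    (hS₀ : NegGenerates A₀ S₀) (hA : ∀ n, (A n).PositiveSelfAdjoint)
    (hA₀ : A₀.PositiveSelfAdjoint)
    (h : ∀ T : ℝ, 0 < T → ∀ f g : H,
      Tendsto (fun n => ∫ t in (0 : ℝ)..T, inner ℂ g (S n t f)) atTop
        (𝓝 (∫ t in (0 : ℝ)..T, inner ℂ g (S₀ t f)))) {s : ℝ} (hs : 0 < s) :
    TendstoWOT (fun n => S n s) (S₀ s) := by
  refine tendstoWOT_iff_inner.2 fun f g => ?_
  have hlip : ∀ {B : OpGraph H} {U : ℝ → H →L[ℂ] H}, NegGenerates B U → B.PositiveSelfAdjoint →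
      LipschitzOnWith (‖innerSL ℂ g‖₊ * (s⁻¹.toNNReal * ‖f‖₊)) (fun t => inner ℂ g (U t f))
        (Ici s) := fun hU hB =>
    (innerSL ℂ g).lipschitz.comp_lipschitzOnWith (hU.lipschitzOnWith_apply hB f hs)
  have hint : ∀ {B : OpGraph H} {U : ℝ → H →L[ℂ] H}, NegGenerates B U → B.PositiveSelfAdjoint →
      ∀ ε > 0, ∫ t in s..s + ε, inner ℂ g (U t f) =
        (∫ t in (0 : ℝ)..s + ε, inner ℂ g (U t f)) - ∫ t in (0 : ℝ)..s, inner ℂ g (U t f) := by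
    intro B U hU hB ε hε
    have hii : ∀ {T : ℝ}, 0 ≤ T → IntervalIntegrable (fun t => inner ℂ g (U t f)) volume 0 T :=
      fun hT =>
        have hU' := hU.intervalIntegrable_apply hB f hT
        ⟨(innerSL ℂ g).integrable_comp hU'.1, (innerSL ℂ g).integrable_comp hU'.2⟩
    exact (intervalIntegral.integral_interval_sub_left (hii (by positivity)) (hii hs.le)).symm
  refine tendsto_of_tendsto_integral_of_lipschitzOnWith (fun n => hlip (hS n) (hA n))
    (hlip hS₀ hA₀) fun ε hε => ?_
  simp only [hint (hS _) (hA _) ε hε, hint hS₀ hA₀ ε hε]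
  exact (h (s + ε) (by positivity) f g).sub (h s hs f g)

lemma resolventTendstoSOT_one_of_tendstoSOT (hS : ∀ n, NegGenerates (A n) (S n))
    (hS₀ : NegGenerates A₀ S₀) (hA : ∀ n, (A n).PositiveSelfAdjoint)
    (hA₀ : A₀.PositiveSelfAdjoint) (h : ∀ t : ℝ, 0 < t → TendstoSOT (fun n => S n t) (S₀ t)) :
    ResolventTendstoSOT A A₀ 1 := by
  refine ⟨resolventsExist hA hA₀ (by simp), tendstoSOT_iff.2 fun f => ?_⟩
  simp only [← (hS _).integral_exp_neg_smul_apply (hA _), ← hS₀.integral_exp_neg_smul_apply hA₀]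
  have hexp : Continuous fun t : ℝ => Real.exp (-t) := by fun_prop
  refine tendsto_integral_of_dominated_convergence (fun t => Real.exp (-t) * ‖f‖)
    (fun n => hexp.aestronglyMeasurable.smul ((hS n).1.aestronglyMeasurable f))
    ((integrableOn_exp_neg_Ioi 0).mul_const _) (fun n => ?_) ?_
  · refine ae_restrict_of_forall_mem measurableSet_Ioi fun t ht => ?_
    rw [norm_smul, Real.norm_of_nonneg (Real.exp_nonneg _)]
    gcongr
    exact (hS n).norm_apply_le (hA n) ht f
  · exact ae_restrict_of_forall_mem measurableSet_Ioi fun t ht =>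
      (tendstoSOT_iff.1 (h t ht) f).const_smul _

lemma tendstoSOT_of_resolventTendstoSOT_one (hS : ∀ n, NegGenerates (A n) (S n))
    (hS₀ : NegGenerates A₀ S₀) (hA : ∀ n, (A n).PositiveSelfAdjoint)
    (hA₀ : A₀.PositiveSelfAdjoint) (h : ResolventTendstoSOT A A₀ 1) {t : ℝ} (ht : 0 < t) :
    TendstoSOT (fun n => S n t) (S₀ t) := by
  rw [hS₀.eqOn_expNeg hA₀ ht]
  simpa only [(hS _).eqOn_expNeg (hA _) ht] using h.tendstoSOT_expNeg hA hA₀ ht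

end SemigroupConvergence

lemma accPt_principal_of_mem_nhds {α : Type*} [TopologicalSpace α] {x : α} [(𝓝[≠] x).NeBot]
    {s : Set α} (hs : s ∈ 𝓝 x) : AccPt x (𝓟 s) := by
  rwa [AccPt, inf_eq_left.2 (le_principal_iff.2 (mem_nhdsWithin_of_mem_nhds hs))]

theorem theorem3p1 {H : Type*} [NormedAddCommGroup H] [InnerProductSpace ℂ H] [CompleteSpace H]
    (A : ℕ → OpGraph H) (A₀ : OpGraph H)
    (hA : ∀ n, OpGraph.SelfAdjoint (A n) ∧ OpGraph.Positive (A n))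
    (hA₀ : OpGraph.SelfAdjoint A₀ ∧ OpGraph.Positive A₀)
    (S : ℕ → ℝ → H →L[ℂ] H) (S₀ : ℝ → H →L[ℂ] H)
    (hS : ∀ n, NegGenerates (A n) (S n)) (hS₀ : NegGenerates A₀ S₀) :
    List.TFAE [
      ∀ t : ℝ, 0 < t → TendstoWOT (fun n => S n t) (S₀ t),
      ∀ T : ℝ, 0 < T → ∀ f g : H,
        Tendsto (fun n => ∫ t in (0 : ℝ)..T, inner ℂ g (S n t f)) atTop
          (𝓝 (∫ t in (0 : ℝ)..T, inner ℂ g (S₀ t f))),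
      ∀ T : ℝ, 0 < T → ∀ (f : H) (g : ℝ → H), IntegrableOn g (Icc 0 T) →
        Tendsto (fun n => ∫ t in (0 : ℝ)..T, inner ℂ (g t) (S n t f)) atTop
          (𝓝 (∫ t in (0 : ℝ)..T, inner ℂ (g t) (S₀ t f))),
      ∀ T : ℝ, 0 < T → ∀ f : H,
        Tendsto (fun n => ∫ t in (0 : ℝ)..T, ‖(S n t - S₀ t) f‖) atTop (𝓝 0),
      ∀ l : ℂ, 0 < l.re → ResolventTendstoSOT A A₀ l,
      ∃ l : ℂ, 0 < l.re ∧ ResolventTendstoSOT A A₀ l,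
      ∀ l : ℂ, 0 < l.re → ResolventTendstoWOT A A₀ l,
      ∃ D : Set ℂ, (∃ μ : ℂ, 0 < μ.re ∧ AccPt μ (𝓟 D)) ∧ ∀ l ∈ D, ResolventTendstoWOT A A₀ l,
      ∃ l : ℂ, l.im ≠ 0 ∧ 0 < l.re ∧ ResolventTendstoWOT A A₀ l,
      ∀ (f : H) (δ T : ℝ), 0 < δ → δ < T →
        Tendsto (fun n => ⨆ t ∈ Icc δ T, ‖(S n t - S₀ t) f‖ₑ) atTop (𝓝 0)] := by
  have hstrong := tendstoSOT_of_forall_tendstoWOT hS hS₀ hA hA₀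
  tfae_have 1 → 3 := fun h _ hT f _ hg => tendsto_integral_inner_of_tendstoWOT hS hA h hT.le f hg
  tfae_have 1 → 4 := fun h _ hT f =>
    tendsto_integral_norm_of_tendstoSOT hS hS₀ hA hA₀ (fun _ => hstrong h) hT.le f
  tfae_have 1 → 6 := fun h =>
    ⟨1, by simp, resolventTendstoSOT_one_of_tendstoSOT hS hS₀ hA hA₀ fun _ => hstrong h⟩
  tfae_have 1 → 10 := fun h f _ _ hδ _ =>
    tendsto_iSup_enorm_of_tendstoSOT hS hA (fun _ => hstrong h) f hδ
  tfae_have 2 → 1 := fun h _ ht => tendstoWOT_of_tendsto_integral_inner hS hS₀ hA hA₀ h ht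
  tfae_have 3 → 2 := fun h T hT f g => h T hT f (fun _ => g) (integrableOn_const (by simp))
  tfae_have 4 → 2 := fun h T hT f g =>
    tendsto_integral_inner_of_tendsto_integral_norm hS hS₀ hA hA₀ hT.le (h T hT f) g
  tfae_have 5 → 1 := fun h _ ht =>
    (tendstoSOT_of_resolventTendstoSOT_one hS hS₀ hA hA₀ (h 1 (by simp)) ht).tendstoWOT
  tfae_have 5 → 7 := fun h l hl => (h l hl).resolventTendstoWOT
  tfae_have 6 → 5 := fun ⟨_, _, h⟩ _ hm => h.of_re_pos hA hA₀ hm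
  tfae_have 7 → 8 := fun h => ⟨{l | 0 < l.re}, ⟨1, by simp, accPt_principal_of_mem_nhds
    ((isOpen_lt continuous_const Complex.continuous_re).mem_nhds (by simp))⟩, h⟩
  tfae_have 7 → 9 := fun h => ⟨1 + Complex.I, by simp, by simp, h _ (by simp)⟩
  tfae_have 8 → 6 := fun ⟨_, ⟨m, hm, hD⟩, h⟩ =>
    ⟨m, hm, resolventTendstoSOT_of_accPt hD h hA hA₀ hm⟩
  tfae_have 9 → 6 := fun ⟨l, him, hl, h⟩ =>
    ⟨l, hl, h.resolventTendstoSOT_of_im_ne_zero hA hA₀ hl him⟩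
  tfae_have 10 → 1 := fun h t ht => (tendstoSOT_iff.2 fun f =>
    tendsto_apply_of_tendsto_iSup_enorm (h f t (t + 1) ht (by simp)) (by simp)).tendstoWOT
  tfae_finish
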